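/- Let the Gregory polynomials $G_n(x)\in\mathbb{Q}[x]$ ($n\ge 0$) be defined by the generating function \[ \frac{t(1+t)^x}{\log(1+t)}=\sum_{n=0}^{\infty}G_n(x)\,t^n . \] For every integer $m\ge 0$ and every real number $x>-1$, the series below converges absolutely, and \[ \gamma = m!\sum_{n=1}^{\infty}\frac{(-1)^{n-1}G_n(x)}{(n)_{m+1}}+H_m-\log(x+m+1), \] where $\gamma$ is Euler's constant, $H_m=\sum_{j=1}^m 1/j$ is the $m$-th harmonic number (with $H_0=0$), and $(n)_{m+1}=n(n+1)\cdots(n+m)$ is the rising factorial. -/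

import Mathlib

open Polynomial

noncomputable section

/-- The formal power series `log (1 + t) / t = ∑ (-1)^n / (n + 1) * t^n` over `ℚ`. -/
def logDivT : PowerSeries ℚ :=
  PowerSeries.mk fun n => (-1 : ℚ) ^ n / ((n : ℚ) + 1)

/-- The formal power series `t (1 + t)^X / log (1 + t)` in `t`, with coefficients in `ℚ[X]`. -/
def gregorySeries : PowerSeries ℚ[X] :=
  PowerSeries.map Polynomial.C logDivT⁻¹ * PowerSeries.binomialSeries ℚ[X] (Polynomial.X : ℚ[X])

/-- The Gregory polynomial `G_n`, the coefficient of `t^n` in `t (1 + t)^X / log (1 + t)`. -/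
def gregoryPoly (n : ℕ) : ℚ[X] :=
  PowerSeries.coeff n gregorySeries

theorem X_mul_logDivT : PowerSeries.X * logDivT = PowerSeries.log ℚ := by
  ext n
  cases n with
  | zero => simp
  | succ n =>
    rw [PowerSeries.coeff_succ_X_mul]
    simp [logDivT, pow_succ]

theorem logDivT_mul_inv : logDivT * logDivT⁻¹ = 1 := by
  apply PowerSeries.mul_inv_cancel
  simp [logDivT, ← PowerSeries.coeff_zero_eq_constantCoeff_apply]

/-- The defining identity `log (1 + t) * ∑ G_n t^n = t (1 + t)^X`. -/
theorem log_mul_gregorySeries :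
    PowerSeries.log ℚ[X] * PowerSeries.mk gregoryPoly =
      PowerSeries.X * PowerSeries.binomialSeries ℚ[X] (Polynomial.X : ℚ[X]) := by
  have h1 : PowerSeries.mk gregoryPoly = gregorySeries := by
    ext1 n
    simp [gregoryPoly]
  have h2 : PowerSeries.log ℚ[X] =
      PowerSeries.X * PowerSeries.map Polynomial.C logDivT := by
    rw [← PowerSeries.map_log (Polynomial.C : ℚ →+* ℚ[X]), ← X_mul_logDivT, map_mul,
      PowerSeries.map_X]
  have h3 : PowerSeries.map (Polynomial.C : ℚ →+* ℚ[X]) logDivT *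
      PowerSeries.map Polynomial.C logDivT⁻¹ = 1 := by
    rw [← map_mul, logDivT_mul_inv, map_one]
  rw [h1, h2, gregorySeries, mul_assoc, ← mul_assoc (PowerSeries.map _ _), h3, one_mul]

/-- The same identity after evaluation at a real number `x`:
`log (1 + t) * ∑ G_n(x) t^n = t (1 + t)^x`. -/
theorem log_mul_gregory_real (x : ℝ) :
    PowerSeries.log ℝ * PowerSeries.mk (fun n => aeval x (gregoryPoly n)) =
      PowerSeries.X * PowerSeries.binomialSeries ℝ x := by
  have h := congrArg (PowerSeries.map (aeval x : ℚ[X] →ₐ[ℚ] ℝ).toRingHom) log_mul_gregorySeries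
  rw [map_mul, map_mul, PowerSeries.map_X, PowerSeries.map_log] at h
  have e1 : PowerSeries.map (aeval x : ℚ[X] →ₐ[ℚ] ℝ).toRingHom (PowerSeries.mk gregoryPoly) =
      PowerSeries.mk (fun n => aeval x (gregoryPoly n)) := by
    ext n
    simp
  have e2 : PowerSeries.map (aeval x : ℚ[X] →ₐ[ℚ] ℝ).toRingHom
      (PowerSeries.binomialSeries ℚ[X] (Polynomial.X : ℚ[X])) =
        PowerSeries.binomialSeries ℝ x := by
    ext n
    simp [Ring.map_choose]
  rw [e1, e2] at h
  exact h

end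

open Filter Topology MeasureTheory

/-! Since `log (1 + t)` times the integral of `(1 + t)^(x + u)` over `0 ≤ u ≤ 1` is `t (1 + t)^x`,
`G_n(x)` is the integral of `Ring.choose (x + u) n` (`aeval_gregoryPoly`). For `y > -1` the sum of
`(-1)^n * Ring.choose y n * B(n + 1, m + 1)` is `1 / (y + m + 1)`; integrating over `y = x + u`
gives a logarithm (`hasSum_gregoryPoly_mul_betaNat`). Let `S_m` be `m!` times the series of the
theorem. Differencing Beta values in `m` shifts their other index, so `S_m - S_(m+1)` is that
integrated series without its zeroth term (`tsum_gregoryPoly_succ_sub`). Hence `S_m + H_m - log (x +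
m + 1)` does not depend on `m`. As `m → ∞`, `S_m → 0` and the rest tends to `γ`. -/

theorem succ_mul_choose_succ (y : ℝ) (n : ℕ) :
    ((n : ℝ) + 1) * Ring.choose y (n + 1) = (y - n) * Ring.choose y n := by
  have h := Ring.choose_smul_choose y (Nat.le_succ n)
  simp only [Nat.succ_eq_add_one, Nat.choose_succ_self_right, nsmul_eq_mul, Nat.add_sub_cancel_left,
    Ring.choose_one_right] at h
  push_cast at h
  linarith

theorem choose_succ_eq (y : ℝ) (n : ℕ) :
    Ring.choose y (n + 1) = (y - n) * Ring.choose y n / ((n : ℝ) + 1) := by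
  rw [← succ_mul_choose_succ]
  field_simp

theorem differentiable_choose (n : ℕ) : Differentiable ℝ fun y : ℝ => Ring.choose y n := by
  induction n with
  | zero => simp
  | succ n ih =>
    simp_rw [choose_succ_eq]
    fun_prop

theorem hasDerivAt_choose_zero (n : ℕ) :
    HasDerivAt (fun y : ℝ => Ring.choose y n) (PowerSeries.coeff n (PowerSeries.log ℝ)) 0 := by
  induction n with
  | zero => simpa using hasDerivAt_const (0 : ℝ) (1 : ℝ)
  | succ n ih =>
    simp_rw [choose_succ_eq]
    have h := ((((hasDerivAt_id (0 : ℝ)).sub_const (n : ℝ)).mul ih).div_const ((n : ℝ) + 1))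
    refine h.congr_deriv ?_
    -- For positive index `Ring.choose 0 n` vanishes, so only one product-rule term survives; index
    -- `0` is the exception.
    rcases n with _ | n
    · simp
    · have h0 : ((n : ℝ) + 1) ≠ 0 := by positivity
      have h1 : ((n : ℝ) + 1 + 1) ≠ 0 := by positivity
      simp [PowerSeries.coeff_log, pow_succ]
      field_simp
      ring

/-- Vandermonde expands `Ring.choose z n` around `y` in powers of the shift `z - y`, read as
binomials, which reduces the derivative to the one at `0`. -/
theorem hasDerivAt_choose (y : ℝ) (n : ℕ) :
    HasDerivAt (fun y : ℝ => Ring.choose y n)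
      (PowerSeries.coeff n (PowerSeries.log ℝ * PowerSeries.binomialSeries ℝ y)) y := by
  have h : HasDerivAt (fun h : ℝ => ∑ ij ∈ Finset.HasAntidiagonal.antidiagonal n,
      Ring.choose h ij.1 * Ring.choose y ij.2)
      (PowerSeries.coeff n (PowerSeries.log ℝ * PowerSeries.binomialSeries ℝ y)) (y - y) := by
    rw [sub_self, PowerSeries.coeff_mul]
    refine HasDerivAt.fun_sum fun ij _ => ?_
    simpa using (hasDerivAt_choose_zero ij.1).mul_const (Ring.choose y ij.2)
  have h2 := h.comp_sub_const y y
  refine h2.congr_of_eventuallyEq (Eventually.of_forall fun z => ?_)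
  simp only
  rw [← Ring.add_choose_eq n (Commute.all _ _), sub_add_cancel]

theorem continuous_choose_add (x : ℝ) (n : ℕ) :
    Continuous fun u : ℝ => Ring.choose (x + u) n :=
  (differentiable_choose n).continuous.comp (by fun_prop)

theorem intervalIntegrable_choose_add (x : ℝ) (n : ℕ) (a b : ℝ) :
    IntervalIntegrable (fun u : ℝ => Ring.choose (x + u) n) volume a b :=
  (continuous_choose_add x n).intervalIntegrable a b

theorem log_mul_integral_choose (x : ℝ) :
    PowerSeries.log ℝ * PowerSeries.mk (fun n => ∫ u in (0 : ℝ)..1, Ring.choose (x + u) n) =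
      PowerSeries.X * PowerSeries.binomialSeries ℝ x := by
  ext n
  have hder : ∀ u : ℝ, HasDerivAt (fun u : ℝ => Ring.choose (x + u) n)
      (PowerSeries.coeff n (PowerSeries.log ℝ * PowerSeries.binomialSeries ℝ (x + u))) u :=
    fun u => by simpa using (hasDerivAt_choose (x + u) n).comp_const_add x u
  have hcont : Continuous fun u : ℝ =>
      PowerSeries.coeff n (PowerSeries.log ℝ * PowerSeries.binomialSeries ℝ (x + u)) := by
    simp only [PowerSeries.coeff_mul, PowerSeries.binomialSeries_coeff, smul_eq_mul, mul_one]
    exact continuous_finsetSum _ fun ij _ => continuous_const.mul (continuous_choose_add x ij.2)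
  have hftc := intervalIntegral.integral_eq_sub_of_hasDerivAt (a := 0) (b := 1)
    (fun u _ => hder u) (hcont.intervalIntegrable 0 1)
  have hsum : PowerSeries.coeff n (PowerSeries.log ℝ *
      PowerSeries.mk (fun n => ∫ u in (0 : ℝ)..1, Ring.choose (x + u) n)) =
      ∫ u in (0 : ℝ)..1,
        PowerSeries.coeff n (PowerSeries.log ℝ * PowerSeries.binomialSeries ℝ (x + u)) := by
    simp only [PowerSeries.coeff_mul, PowerSeries.binomialSeries_coeff, smul_eq_mul, mul_one,
      PowerSeries.coeff_mk]
    rw [intervalIntegral.integral_finsetSum fun ij _ =>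
      (intervalIntegrable_choose_add x ij.2 0 1).const_mul _]
    simp_rw [intervalIntegral.integral_const_mul]
  rw [hsum, hftc]
  cases n with
  | zero => simp
  | succ n => simp [PowerSeries.coeff_succ_X_mul, Ring.choose_succ_succ]

theorem aeval_gregoryPoly (x : ℝ) (n : ℕ) :
    aeval x (gregoryPoly n) = ∫ u in (0 : ℝ)..1, Ring.choose (x + u) n := by
  have hlog : PowerSeries.log ℝ ≠ 0 := by
    intro h
    have := PowerSeries.coeff_one_log (A := ℝ)
    simp [h] at this
  have h := mul_left_cancel₀ hlog ((log_mul_gregory_real x).trans (log_mul_integral_choose x).symm)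
  simpa using congrArg (PowerSeries.coeff n) h

/-! ### Absolute convergence -/

/-- A Raabe-type test: the hypothesis bounds `A n / (n + 1)` by a telescoping difference. `A` is
eventually decreasing, and a positive limit would make the harmonic series converge. -/
theorem summable_div_and_tendsto_zero {A : ℕ → ℝ} {δ : ℝ} {N : ℕ} (hδ : 0 < δ)
    (hA : ∀ n, 0 ≤ A n) (h : ∀ n ≥ N, δ * A n ≤ (n + 1) * (A n - A (n + 1))) :
    Summable (fun n => A n / ((n : ℝ) + 1)) ∧ Tendsto A atTop (𝓝 0) := by
  have hstep : ∀ n ≥ N, A n / ((n : ℝ) + 1) ≤ (A n - A (n + 1)) / δ := by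
    intro n hn
    rw [div_le_div_iff₀ (by positivity) hδ]
    linarith [h n hn]
  have hmono : ∀ n ≥ N, A (n + 1) ≤ A n := by
    intro n hn
    have h1 : 0 ≤ (A n - A (n + 1)) / δ := le_trans (by have := hA n; positivity) (hstep n hn)
    have h2 : 0 ≤ A n - A (n + 1) := by
      by_contra hneg
      exact absurd h1 (not_le.2 (div_neg_of_neg_of_pos (not_le.1 hneg) hδ))
    linarith
  have hsum : Summable (fun n => A n / ((n : ℝ) + 1)) := by
    rw [← summable_nat_add_iff N]
    refine summable_of_sum_range_le (c := A N / δ) (fun n => by have := hA (n + N); positivity) ?_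
    intro K
    have hK : ∑ i ∈ Finset.range K, A (i + N) / (((i + N : ℕ) : ℝ) + 1) ≤
        (A N - A (K + N)) / δ := by
      induction K with
      | zero => simp
      | succ K ih =>
        rw [Finset.sum_range_succ]
        have := hstep (K + N) (by omega)
        rw [show K + 1 + N = K + N + 1 by omega]
        calc _ ≤ (A N - A (K + N)) / δ + (A (K + N) - A (K + N + 1)) / δ := by gcongr
          _ = _ := by ring
    refine hK.trans ?_
    gcongr
    linarith [hA (K + N)]
  refine ⟨hsum, ?_⟩
  have hanti : Antitone fun n => A (n + N) :=
    antitone_nat_of_succ_le fun n => by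
      have := hmono (n + N) (by omega)
      rwa [show n + N + 1 = n + 1 + N by omega] at this
  have hbdd : BddBelow (Set.range fun n => A (n + N)) :=
    ⟨0, by rintro _ ⟨n, rfl⟩; exact hA _⟩
  have hlim := tendsto_atTop_ciInf hanti hbdd
  set l := ⨅ n, A (n + N) with hl
  have hle : ∀ n, l ≤ A (n + N) := fun n => ciInf_le hbdd n
  have hl0 : 0 ≤ l := le_ciInf fun n => hA _
  have hl1 : l = 0 := by
    by_contra hne
    have hpos : 0 < l := lt_of_le_of_ne hl0 (Ne.symm hne)
    have hs : Summable fun n : ℕ => l / (((n + N : ℕ) : ℝ) + 1) := by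
      refine Summable.of_nonneg_of_le (fun n => by positivity) (fun n => ?_)
        ((summable_nat_add_iff N).2 hsum)
      gcongr
      exact hle n
    have hs2 : Summable fun n : ℕ => l / ((n : ℝ) + 1) :=
      (summable_nat_add_iff (f := fun n : ℕ => l / ((n : ℝ) + 1)) N).1 hs
    have hs3 : Summable fun n : ℕ => 1 / ((n : ℝ) + 1) := by
      refine (hs2.mul_left l⁻¹).congr fun n => ?_
      field_simp
    refine Real.not_summable_one_div_natCast ((summable_nat_add_iff 1).1 ?_)
    simpa using hs3
  rw [hl1] at hlim
  exact (tendsto_add_atTop_iff_nat N).1 hlim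

theorem abs_choose_step {δ y : ℝ} {n : ℕ} (hδ : δ ≤ y + 1) (hn : y ≤ n) :
    δ * |Ring.choose y n| ≤ (n + 1) * (|Ring.choose y n| - |Ring.choose y (n + 1)|) := by
  have h : ((n : ℝ) + 1) * |Ring.choose y (n + 1)| = (n - y) * |Ring.choose y n| := by
    rw [← abs_of_nonneg (sub_nonneg.2 hn), abs_sub_comm, ← abs_mul, ← succ_mul_choose_succ, abs_mul,
      abs_of_pos (by positivity : (0 : ℝ) < n + 1)]
  have h2 := mul_le_mul_of_nonneg_right hδ (abs_nonneg (Ring.choose y n))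
  linarith

theorem summable_abs_choose_and_tendsto_zero {y : ℝ} (hy : -1 < y) :
    Summable (fun n : ℕ => |Ring.choose y n| / ((n : ℝ) + 1)) ∧
      Tendsto (fun n => |Ring.choose y n|) atTop (𝓝 0) := by
  obtain ⟨N, hN⟩ := exists_nat_ge y
  exact summable_div_and_tendsto_zero (δ := y + 1) (N := N) (by linarith) (fun n => abs_nonneg _)
    fun n hn => abs_choose_step le_rfl (hN.trans (by exact_mod_cast hn))

/-- The Raabe inequality holds with `δ = x + 1` and one threshold `N` for all `u` in `[0, 1]`, so it
survives integration. -/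
theorem summable_integral_abs_choose {x : ℝ} (hx : -1 < x) :
    Summable fun n : ℕ => (∫ u in (0 : ℝ)..1, |Ring.choose (x + u) n|) / ((n : ℝ) + 1) := by
  obtain ⟨N, hN⟩ := exists_nat_ge (x + 1)
  have hi : ∀ n, IntervalIntegrable (fun u : ℝ => |Ring.choose (x + u) n|) volume 0 1 :=
    fun n => (continuous_choose_add x n).abs.intervalIntegrable 0 1
  refine (summable_div_and_tendsto_zero (δ := x + 1) (N := N) (by linarith)
    (fun n => intervalIntegral.integral_nonneg zero_le_one fun u _ => abs_nonneg _)
    fun n hn => ?_).1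
  rw [← intervalIntegral.integral_sub (hi n) (hi (n + 1)), ← intervalIntegral.integral_const_mul,
    ← intervalIntegral.integral_const_mul]
  refine intervalIntegral.integral_mono_on zero_le_one ((hi n).const_mul _)
    (((hi n).sub (hi (n + 1))).const_mul _) fun u hu => abs_choose_step (by linarith [hu.1]) ?_
  have : (N : ℝ) ≤ n := by exact_mod_cast hn
  linarith [hu.2]

/-! ### Beta values and their binomial sums -/

/-- The Beta value `B(k + 1, m + 1) = m! / ((k + 1) (k + 2) ⋯ (k + 1 + m))`. -/
noncomputable def betaNat (m k : ℕ) : ℝ :=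
  (m.factorial : ℝ) / ((k + 1).ascFactorial (m + 1) : ℝ)

theorem betaNat_nonneg (m k : ℕ) : 0 ≤ betaNat m k := by
  unfold betaNat
  positivity

theorem betaNat_zero_right (m : ℕ) : betaNat m 0 = 1 / ((m : ℝ) + 1) := by
  have : (m.factorial : ℝ) ≠ 0 := by positivity
  simp only [betaNat, zero_add, Nat.one_ascFactorial, Nat.factorial_succ]
  push_cast
  field_simp

theorem betaNat_succ_right (m k : ℕ) :
    ((k : ℝ) + m + 2) * betaNat m (k + 1) = (k + 1) * betaNat m k := by
  have h0 : ((k + 1).ascFactorial (m + 1) : ℝ) ≠ 0 := by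
    exact_mod_cast (Nat.ascFactorial_pos k (m + 1)).ne'
  have h1 : ((k + 1 + 1).ascFactorial (m + 1) : ℝ) ≠ 0 := by
    exact_mod_cast (Nat.ascFactorial_pos (k + 1) (m + 1)).ne'
  have h : ((k : ℝ) + 1) * ((k + 1 + 1).ascFactorial (m + 1) : ℝ) =
      ((k : ℝ) + 1 + (m + 1)) * ((k + 1).ascFactorial (m + 1) : ℝ) := by
    exact_mod_cast Nat.succ_ascFactorial (k + 1) (m + 1)
  unfold betaNat
  field_simp
  linarith

theorem betaNat_succ_left (m k : ℕ) :
    ((k : ℝ) + m + 2) * betaNat (m + 1) k = (m + 1) * betaNat m k := by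
  have h0 : ((k + 1).ascFactorial (m + 1) : ℝ) ≠ 0 := by
    exact_mod_cast (Nat.ascFactorial_pos k (m + 1)).ne'
  have h1 : ((k : ℝ) + 1 + (m + 1)) ≠ 0 := by positivity
  rw [betaNat, betaNat, Nat.ascFactorial_succ, Nat.factorial_succ]
  push_cast
  field_simp
  ring

theorem betaNat_sub_succ_left (m k : ℕ) :
    betaNat m k - betaNat (m + 1) k = betaNat m (k + 1) := by
  have h0 : ((k : ℝ) + m + 2) ≠ 0 := by positivity
  apply mul_left_cancel₀ h0
  rw [mul_sub, betaNat_succ_left, betaNat_succ_right]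
  ring

theorem betaNat_le_left (m k : ℕ) : betaNat m k ≤ 1 / ((m : ℝ) + 1) := by
  rw [← betaNat_zero_right]
  unfold betaNat
  have h0 : (0 : ℝ) < (0 + 1).ascFactorial (m + 1) := by
    exact_mod_cast Nat.ascFactorial_pos 0 (m + 1)
  gcongr
  exact k.zero_le

theorem betaNat_le_right (m k : ℕ) : betaNat m k ≤ 1 / ((k : ℝ) + 1) := by
  have hn : m.factorial * (k + 1) ≤ (k + 1).ascFactorial (m + 1) := by
    have h1 : (k + 1).ascFactorial (m + 1) = (k + 1) * (k + 1 + 1).ascFactorial m := by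
      rw [Nat.succ_ascFactorial (k + 1) m, Nat.ascFactorial_succ]
    rw [h1, ← Nat.one_ascFactorial, mul_comm]
    exact Nat.mul_le_mul_left _ (Nat.ascFactorial_le m (by omega))
  have h0 : (0 : ℝ) < (k + 1).ascFactorial (m + 1) := by
    exact_mod_cast Nat.ascFactorial_pos k (m + 1)
  unfold betaNat
  rw [div_le_div_iff₀ h0 (by positivity), one_mul]
  exact_mod_cast hn

/-- The two one-step recurrences, for binomials and for Beta values, make the partial sums
telescope. -/
theorem sum_range_choose_mul_betaNat {y : ℝ} {m : ℕ} (hy : y + m + 1 ≠ 0) (n : ℕ) :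
    ∑ k ∈ Finset.range n, (-1 : ℝ) ^ k * Ring.choose y k * betaNat m k =
      (1 - (-1) ^ n * Ring.choose y n * ((n + m + 1) * betaNat m n)) / (y + m + 1) := by
  induction n with
  | zero =>
    have h : ((m : ℝ) + 1) ≠ 0 := by positivity
    simp [betaNat_zero_right, h]
  | succ n ih =>
    have h1 := betaNat_succ_right m n
    have h2 := succ_mul_choose_succ y n
    rw [Finset.sum_range_succ, ih, eq_div_iff hy, add_mul, div_mul_cancel₀ _ hy]
    push_cast
    rw [show (n : ℝ) + 1 + m + 1 = n + m + 2 by ring, h1, pow_succ]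
    linear_combination (-1 : ℝ) ^ n * betaNat m n * -h2

theorem abs_choose_mul_betaNat_le (y : ℝ) (m n : ℕ) :
    |(-1 : ℝ) ^ n * Ring.choose y n * betaNat m n| ≤ |Ring.choose y n| / (n + 1) := by
  rw [abs_mul, abs_mul, abs_pow, abs_neg, abs_one, one_pow, one_mul,
    abs_of_nonneg (betaNat_nonneg m n), div_eq_mul_one_div]
  gcongr
  exact betaNat_le_right m n

theorem tendsto_sum_choose_mul_betaNat {y : ℝ} (hy : -1 < y) (m : ℕ) :
    Tendsto (fun n => ∑ k ∈ Finset.range n, (-1 : ℝ) ^ k * Ring.choose y k * betaNat m k)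
      atTop (𝓝 (1 / (y + m + 1))) := by
  have hm : (0 : ℝ) ≤ m := m.cast_nonneg
  simp_rw [sum_range_choose_mul_betaNat (show y + m + 1 ≠ 0 by linarith)]
  have h : Tendsto (fun n : ℕ => (-1 : ℝ) ^ n * Ring.choose y n * ((n + m + 1) * betaNat m n))
      atTop (𝓝 0) := by
    refine squeeze_zero_norm (a := fun n => |Ring.choose y n| * (m + 1)) (fun n => ?_) ?_
    · have h1 := betaNat_le_right m n
      have h2 : ((n : ℝ) + m + 1) * betaNat m n ≤ m + 1 := by
        calc ((n : ℝ) + m + 1) * betaNat m n ≤ ((n : ℝ) + m + 1) * (1 / (n + 1)) := by gcongr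
          _ ≤ m + 1 := by
            rw [mul_one_div, div_le_iff₀ (by positivity)]
            nlinarith [mul_nonneg hm (n.cast_nonneg : (0 : ℝ) ≤ n)]
      have h3 : 0 ≤ ((n : ℝ) + m + 1) * betaNat m n :=
        mul_nonneg (by positivity) (betaNat_nonneg m n)
      rw [Real.norm_eq_abs, abs_mul, abs_mul, abs_pow, abs_neg, abs_one, one_pow, one_mul,
        abs_of_nonneg h3]
      gcongr
    · simpa using (summable_abs_choose_and_tendsto_zero hy).2.mul_const ((m : ℝ) + 1)
  simpa using (h.const_sub 1).div_const (y + m + 1)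

/-! ### Gregory series and the limit in `m` -/

theorem abs_aeval_gregoryPoly_le (x : ℝ) (n : ℕ) :
    |aeval x (gregoryPoly n)| ≤ ∫ u in (0 : ℝ)..1, |Ring.choose (x + u) n| := by
  rw [aeval_gregoryPoly]
  exact intervalIntegral.abs_integral_le_integral_abs zero_le_one

theorem integral_one_div_add {a : ℝ} (ha : 0 < a) :
    ∫ u in (0 : ℝ)..1, 1 / (a + u) = Real.log (a + 1) - Real.log a := by
  rw [intervalIntegral.integral_comp_add_left (fun u => 1 / u) a, add_zero,
    integral_one_div_of_pos ha (by linarith), Real.log_div (by linarith) ha.ne']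

theorem hasSum_gregoryPoly_mul_betaNat {x : ℝ} (hx : -1 < x) (m : ℕ) :
    HasSum (fun n : ℕ => (-1 : ℝ) ^ n * aeval x (gregoryPoly n) * betaNat m n)
      (Real.log (x + m + 2) - Real.log (x + m + 1)) := by
  have hm : (0 : ℝ) ≤ m := m.cast_nonneg
  set F : ℕ → ℝ → ℝ := fun n u => (-1 : ℝ) ^ n * Ring.choose (x + u) n * betaNat m n with hF
  have hcont : ∀ n, Continuous (F n) := fun n =>
    (continuous_const.mul (continuous_choose_add x n)).mul continuous_const
  have hFi : ∀ n, ∫ u in Set.Ioc (0 : ℝ) 1, F n u =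
      (-1 : ℝ) ^ n * aeval x (gregoryPoly n) * betaNat m n := by
    intro n
    rw [← intervalIntegral.integral_of_le zero_le_one, aeval_gregoryPoly,
      intervalIntegral.integral_mul_const, intervalIntegral.integral_const_mul]
  have hnorm : ∀ n, ∫ u in Set.Ioc (0 : ℝ) 1, ‖F n u‖ ≤
      (∫ u in (0 : ℝ)..1, |Ring.choose (x + u) n|) / ((n : ℝ) + 1) := by
    intro n
    rw [← intervalIntegral.integral_of_le zero_le_one, ← intervalIntegral.integral_div]
    exact intervalIntegral.integral_mono_on zero_le_one ((hcont n).norm.intervalIntegrable _ _)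
      (((continuous_choose_add x n).abs.div_const _).intervalIntegrable _ _)
      fun u _ => abs_choose_mul_betaNat_le (x + u) m n
  have hsum : Summable fun n => ∫ u in Set.Ioc (0 : ℝ) 1, ‖F n u‖ :=
    Summable.of_nonneg_of_le (fun n => integral_nonneg fun u => norm_nonneg _) hnorm
      (summable_integral_abs_choose hx)
  have hint : ∀ n, Integrable (F n) (volume.restrict (Set.Ioc (0 : ℝ) 1)) := fun n =>
    ((hcont n).intervalIntegrable 0 1).1
  have hS := hasSum_integral_of_summable_integral_norm hint hsum
  simp_rw [hFi] at hS
  have htsum : ∀ u ∈ Set.Ioc (0 : ℝ) 1, ∑' n, F n u = 1 / (x + m + 1 + u) := by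
    intro u hu
    have hy : -1 < x + u := by linarith [hu.1]
    have hs : Summable fun n => F n u :=
      (summable_abs_choose_and_tendsto_zero hy).1.of_norm_bounded
        fun n => abs_choose_mul_betaNat_le (x + u) m n
    rw [tendsto_nhds_unique hs.hasSum.tendsto_sum_nat (tendsto_sum_choose_mul_betaNat hy m)]
    congr 1
    ring
  rw [setIntegral_congr_fun measurableSet_Ioc htsum, ← intervalIntegral.integral_of_le zero_le_one,
    integral_one_div_add (by linarith), show x + m + 1 + 1 = x + m + 2 by ring] at hS
  exact hS

theorem abs_gregoryPoly_succ_mul_betaNat_le (x : ℝ) (m k : ℕ) :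
    |(-1 : ℝ) ^ k * aeval x (gregoryPoly (k + 1)) * betaNat m k| ≤
      2 * ((∫ u in (0 : ℝ)..1, |Ring.choose (x + u) (k + 1)|) / (((k + 1 : ℕ) : ℝ) + 1)) := by
  -- The factor 2 pays for the mismatch between index `k` of the Beta value and `k + 1` of the
  -- polynomial.
  have h1 : (1 : ℝ) / (k + 1) ≤ 2 * (1 / (((k + 1 : ℕ) : ℝ) + 1)) := by
    push_cast
    rw [mul_one_div, div_le_div_iff₀ (by positivity) (by positivity)]
    linarith [(k.cast_nonneg : (0 : ℝ) ≤ k)]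
  rw [abs_mul, abs_mul, abs_pow, abs_neg, abs_one, one_pow, one_mul,
    abs_of_nonneg (betaNat_nonneg m k), div_eq_mul_one_div, mul_left_comm]
  exact mul_le_mul (abs_aeval_gregoryPoly_le x (k + 1)) ((betaNat_le_right m k).trans h1)
    (betaNat_nonneg m k) ((abs_nonneg _).trans (abs_aeval_gregoryPoly_le x (k + 1)))

theorem summable_gregoryPoly_succ_bound {x : ℝ} (hx : -1 < x) :
    Summable fun k : ℕ =>
      2 * ((∫ u in (0 : ℝ)..1, |Ring.choose (x + u) (k + 1)|) / (((k + 1 : ℕ) : ℝ) + 1)) :=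
  ((summable_nat_add_iff 1).2 (summable_integral_abs_choose hx)).mul_left 2

theorem summable_gregoryPoly_succ_mul_betaNat {x : ℝ} (hx : -1 < x) (m : ℕ) :
    Summable fun k : ℕ => (-1 : ℝ) ^ k * aeval x (gregoryPoly (k + 1)) * betaNat m k :=
  (summable_gregoryPoly_succ_bound hx).of_norm_bounded
    fun k => abs_gregoryPoly_succ_mul_betaNat_le x m k

theorem tsum_gregoryPoly_succ_sub {x : ℝ} (hx : -1 < x) (m : ℕ) :
    (∑' k : ℕ, (-1 : ℝ) ^ k * aeval x (gregoryPoly (k + 1)) * betaNat m k) -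
      (∑' k : ℕ, (-1 : ℝ) ^ k * aeval x (gregoryPoly (k + 1)) * betaNat (m + 1) k) =
      1 / ((m : ℝ) + 1) - (Real.log (x + m + 2) - Real.log (x + m + 1)) := by
  rw [← (summable_gregoryPoly_succ_mul_betaNat hx m).tsum_sub
    (summable_gregoryPoly_succ_mul_betaNat hx (m + 1))]
  have h := ((hasSum_nat_add_iff' 1).2 (hasSum_gregoryPoly_mul_betaNat hx m)).neg
  have h0 : aeval x (gregoryPoly 0) = (1 : ℝ) := by simp [aeval_gregoryPoly]
  simp only [Finset.range_one, Finset.sum_singleton, pow_zero, one_mul, h0,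
    betaNat_zero_right, neg_sub] at h
  rw [← h.tsum_eq]
  refine tsum_congr fun k => ?_
  rw [← mul_sub, betaNat_sub_succ_left, pow_succ]
  ring

/-- Dominated convergence: the summable bound is independent of `m`, while each Beta value is at
most `1 / (m + 1)`. -/
theorem tendsto_tsum_gregoryPoly_succ {x : ℝ} (hx : -1 < x) :
    Tendsto (fun m : ℕ =>
      ∑' k : ℕ, (-1 : ℝ) ^ k * aeval x (gregoryPoly (k + 1)) * betaNat m k) atTop (𝓝 0) := by
  have hb : ∀ k, Tendsto (fun m => betaNat m k) atTop (𝓝 0) := fun k =>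
    squeeze_zero (fun m => betaNat_nonneg m k) (fun m => betaNat_le_left m k)
      tendsto_one_div_add_atTop_nhds_zero_nat
  have h := tendsto_tsum_of_dominated_convergence (𝓕 := atTop) (summable_gregoryPoly_succ_bound hx)
    (fun k => (hb k).const_mul ((-1 : ℝ) ^ k * aeval x (gregoryPoly (k + 1))))
    (Eventually.of_forall fun m k => abs_gregoryPoly_succ_mul_betaNat_le x m k)
  simpa using h

theorem tendsto_harmonic_sub_log_add {x : ℝ} (hx : -1 < x) :
    Tendsto (fun m : ℕ => (harmonic m : ℝ) - Real.log (x + m + 1)) atTop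
      (𝓝 Real.eulerMascheroniConstant) := by
  have hr : Tendsto (fun m : ℕ => 1 + x / ((m : ℝ) + 1)) atTop (𝓝 1) := by
    simpa [div_eq_mul_inv] using
      ((tendsto_one_div_add_atTop_nhds_zero_nat (𝕜 := ℝ)).const_mul x).const_add 1
  have hl := (Real.continuousAt_log one_ne_zero).tendsto.comp hr
  have h := Real.tendsto_harmonic_sub_log_add_one.sub hl
  rw [Real.log_one, sub_zero] at h
  refine h.congr fun m => ?_
  have hm : (0 : ℝ) < (m : ℝ) + 1 := by positivity
  have hxm : 0 < x + m + 1 := by linarith [(m.cast_nonneg : (0 : ℝ) ≤ m)]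
  have e : 1 + x / ((m : ℝ) + 1) = (x + m + 1) / (m + 1) := by
    field_simp
    ring
  simp only [Function.comp_apply, e]
  rw [Real.log_div hxm.ne' hm.ne']
  ring

theorem tsum_gregoryPoly_succ_mul_betaNat {x : ℝ} (hx : -1 < x) (m : ℕ) :
    (∑' k : ℕ, (-1 : ℝ) ^ k * aeval x (gregoryPoly (k + 1)) * betaNat m k) +
      ((harmonic m : ℝ) - Real.log (x + m + 1)) = Real.eulerMascheroniConstant := by
  set E : ℕ → ℝ := fun m =>
    (∑' k : ℕ, (-1 : ℝ) ^ k * aeval x (gregoryPoly (k + 1)) * betaNat m k) +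
      ((harmonic m : ℝ) - Real.log (x + m + 1)) with hE
  have hstep : ∀ m, E (m + 1) = E m := by
    intro m
    have h := tsum_gregoryPoly_succ_sub hx m
    simp only [hE, harmonic_succ]
    push_cast
    rw [show x + ((m : ℝ) + 1) + 1 = x + m + 2 by ring]
    rw [one_div] at h
    linarith
  have hconst : ∀ n, E (m + n) = E m := by
    intro n
    induction n with
    | zero => rfl
    | succ n ih => rw [← add_assoc, hstep, ih]
  have hlim : Tendsto E atTop (𝓝 Real.eulerMascheroniConstant) := by
    simpa using (tendsto_tsum_gregoryPoly_succ hx).add (tendsto_harmonic_sub_log_add hx)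
  refine tendsto_nhds_unique (f := fun _ : ℕ => E m) (l := atTop) tendsto_const_nhds ?_
  refine ((tendsto_add_atTop_iff_nat m).2 hlim).congr fun n => ?_
  rw [add_comm, hconst]

/-- Here the series is indexed by `k = n - 1`, `gregoryPoly` is the family of Gregory polynomials
and `(k + 1).ascFactorial (m + 1) = (k + 1) (k + 2) ⋯ (k + 1 + m)` is the rising factorial. -/
theorem mainTheorem6 (m : ℕ) (x : ℝ) (hx : -1 < x) :
    Summable (fun k : ℕ =>
      (-1 : ℝ) ^ k * aeval x (gregoryPoly (k + 1)) / ((k + 1).ascFactorial (m + 1) : ℝ)) ∧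
    Real.eulerMascheroniConstant =
      (m.factorial : ℝ) * (∑' k : ℕ,
        (-1 : ℝ) ^ k * aeval x (gregoryPoly (k + 1)) / ((k + 1).ascFactorial (m + 1) : ℝ))
      + (harmonic m : ℝ) - Real.log (x + m + 1) := by
  have hterm : ∀ k : ℕ, (-1 : ℝ) ^ k * aeval x (gregoryPoly (k + 1)) * betaNat m k =
      (m.factorial : ℝ) * ((-1 : ℝ) ^ k * aeval x (gregoryPoly (k + 1)) /
        ((k + 1).ascFactorial (m + 1) : ℝ)) := fun k => by
    unfold betaNat
    ring
  have hs := summable_gregoryPoly_succ_mul_betaNat hx m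
  have ht := tsum_gregoryPoly_succ_mul_betaNat hx m
  simp_rw [hterm] at hs ht
  rw [tsum_mul_left] at ht
  refine ⟨(summable_mul_left_iff (by positivity)).1 hs, ?_⟩
  linarith
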